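/- Let $G$ be a complex Banach space and $B(G)$ the algebra of bounded operators on $G$. A countably additive spectral measure is a map $E$ from the Borel subsets of $\mathbb C$ to the projectors in $B(G)$ with $E(\mathbb C)=1$, $E(\emptyset)=0$, $E(\sigma\cap\delta)=E(\sigma)E(\delta)$, $E(\sigma\cup\delta)=E(\sigma)+E(\delta)-E(\sigma)E(\delta)$, such that $\sigma\mapsto\phi(E(\sigma)x)$ is countably additive for all $x\in G$, $\phi\in G^*$. Its support is $S=\bigcap\{\overline\sigma : \sigma \text{ Borel},\ E(\sigma)=1\}$. For a Borel function $f:S\to\mathbb C$ let $f_n:\mathbb C\to\mathbb C$ be equal to $f$ on $\{\lambda\in S:|f(\lambda)|\le n\}$ and $0$ elsewhere; $f(E)$ is the operator $f(E)x=\lim_{n}\left(\int f_n\,dE\right)x$ whose domain is the set of all $x\in G$ for which the limit exists in $G$, where the integral of a bounded Borel function is the operator-norm limit of the integrals of uniformly approximating Borel simple functions. A linear operator $R$ in $G$ is called scalar type spectral if $R=\imath(E)$ for some such $E$, with $\imath(\lambda)=\lambda$; then $E$ is unique, its support is the spectrum $\sigma(R)$, and for every function $f$ that is defined at least on $\sigma(R)$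 and Borel there, $f(R):=f(E)$ (only the restriction of $f$ to $\sigma(R)$ matters). **Theorem.** Let $T\in B(G)$ be a scalar type spectral operator, $0<L\le\infty$, $U\subseteq\mathbb C$ an open set with $\sigma(T)\subseteq U$ and $t\lambda\in U$ for all $t\in\,]-L,L[$ and $\lambda\in U$, and let $F:U\to\mathbb C$ be analytic, with derivative $F'$. For $t\in\,]-L,L[$ put $F_t(\lambda)=F(t\lambda)$, $\lambda\in U$. Then for every $t\in\,]-L,L[$ the operator $tT$ is scalar type spectral with $\sigma(tT)\subseteq U$, the operators $F(tT)$ and $F'(tT)$ (formed by the functional calculus of $tT$) and $F_t(T)$ (formed by that of $T$) belong to $B(G)$, and: 1. $F(tT)=F_t(T)$ for all $t\in\,]-L,L[$; 2. the map $t\mapsto F(tT)\in B(G)$ is differentiable on $]-L,L[$ in the operator norm, and $\dfrac{d}{dt}F(tT)=T\,F'(tT)$; 3. for all $u_1,u_2\in\,]-L,L[$ the map $t\mapsto F'(tT)$ is Bochner integrable in $B(G)$ with the operator norm between $u_1$ and $u_2$, and $$T\int_{u_1}^{u_2}F'(tT)\,dt=F(u_2T)-F(u_1T).$$ -/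

import Mathlib

open Filter Topology MeasureTheory

/-- A countably additive spectral measure in `G` on the Borel subsets of `ℂ`: a map with values in
the projectors of `G`, multiplicative on intersections, normalized, and countably additive for the
weak operator topology. Only the values on Borel sets are constrained (and used). -/
structure IsSpectralMeasure {G : Type*} [NormedAddCommGroup G] [NormedSpace ℂ G]
    (E : Set ℂ → (G →L[ℂ] G)) : Prop where
  proj : ∀ s, MeasurableSet s → E s * E s = E s
  inter : ∀ s t, MeasurableSet s → MeasurableSet t → E (s ∩ t) = E s * E t
  union : ∀ s t, MeasurableSet s → MeasurableSet t → E (s ∪ t) = E s + E t - E s * E t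
  univ : E Set.univ = 1
  empty : E ∅ = 0
  weak_countably_additive : ∀ s : ℕ → Set ℂ, (∀ n, MeasurableSet (s n)) →
    Pairwise (fun m n => Disjoint (s m) (s n)) → ∀ (x : G) (φ : StrongDual ℂ G),
      HasSum (fun n => φ (E (s n) x)) (φ (E (⋃ n, s n) x))

namespace SpectralMeasure

variable {G : Type*} [NormedAddCommGroup G] [NormedSpace ℂ G]

/-- The support: the intersection of the closures of all Borel sets `s` with `E s = 1`. -/
def supp (E : Set ℂ → (G →L[ℂ] G)) : Set ℂ :=
  ⋂ s ∈ {s : Set ℂ | MeasurableSet s ∧ E s = 1}, closure s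

/-- The integral `∑ c, c • E (s = c)` of a Borel simple function. -/
noncomputable def simpleIntegral (E : Set ℂ → (G →L[ℂ] G)) (s : SimpleFunc ℂ ℂ) : G →L[ℂ] G :=
  ∑ c ∈ s.range, c • E (s ⁻¹' {c})

/-- `A` is the integral of `f` with respect to `E`: the limit in operator norm of the integrals of
Borel simple functions that converge to `f` uniformly on `ℂ`. -/
def HasSpectralIntegral (E : Set ℂ → (G →L[ℂ] G)) (f : ℂ → ℂ) (A : G →L[ℂ] G) : Prop :=
  ∃ s : ℕ → SimpleFunc ℂ ℂ, TendstoUniformly (fun n z => s n z) f atTop ∧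
    Tendsto (fun n => simpleIntegral E (s n)) atTop (𝓝 A)

open Classical in
/-- The integral of a totally measurable (for instance a bounded Borel) function `f : ℂ → ℂ`;
it is `0` if the integral does not exist. -/
noncomputable def spectralIntegral (E : Set ℂ → (G →L[ℂ] G)) (f : ℂ → ℂ) : G →L[ℂ] G :=
  if h : ∃ A, HasSpectralIntegral E f A then h.choose else 0

/-- The truncation `f_n`: equal to `f` on the points of the support of `E` at which `|f| ≤ n`,
and `0` elsewhere. -/
noncomputable def trunc (E : Set ℂ → (G →L[ℂ] G)) (f : ℂ → ℂ) (n : ℕ) : ℂ → ℂ :=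
  Set.indicator (supp E ∩ {z | ‖f z‖ ≤ n}) f

/-- The Borel functional calculus of a spectral measure: `f(E)` is the (possibly unbounded)
operator `x ↦ lim_n (∫ f_n dE) x`, whose domain is the set of all `x` for which the limit exists.
Only the restriction of `f` to the support of `E` matters. -/
noncomputable def calculus (E : Set ℂ → (G →L[ℂ] G)) (f : ℂ → ℂ) : G →ₗ.[ℂ] G where
  domain :=
    { carrier := {x | ∃ y, Tendsto (fun n => spectralIntegral E (trunc E f n) x) atTop (𝓝 y)}
      zero_mem' := ⟨0, by simp⟩
      add_mem' := by
        rintro x x' ⟨y, hy⟩ ⟨y', hy'⟩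
        exact ⟨y + y', by simpa using hy.add hy'⟩
      smul_mem' := by
        rintro c x ⟨y, hy⟩
        exact ⟨c • y, by simpa using hy.const_smul c⟩ }
  toFun :=
    { toFun := fun x => x.2.choose
      map_add' := by
        intro x x'
        refine tendsto_nhds_unique (x + x').2.choose_spec ?_
        simpa using x.2.choose_spec.add x'.2.choose_spec
      map_smul' := by
        intro c x
        refine tendsto_nhds_unique (c • x).2.choose_spec ?_
        simpa using x.2.choose_spec.const_smul c }

/-- `E` is a resolution of the identity of the scalar type spectral operator `R`: `E` is a countably
additive spectral measure and `R = ι(E)`, where `ι` is the identity function. -/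
def IsResolution (R : G →ₗ.[ℂ] G) (E : Set ℂ → (G →L[ℂ] G)) : Prop :=
  IsSpectralMeasure E ∧ R = calculus E (fun z => z)

end SpectralMeasure

/-- A bounded operator, regarded as a linear operator in `G` whose domain is all of `G`. -/
def ContinuousLinearMap.everywhere {G : Type*} [NormedAddCommGroup G] [NormedSpace ℂ G]
    (T : G →L[ℂ] G) : G →ₗ.[ℂ] G :=
  (T : G →ₗ[ℂ] G).toPMap ⊤

/-- A (possibly unbounded) scalar type spectral operator in `G`. -/
def IsScalarTypeSpectral {G : Type*} [NormedAddCommGroup G] [NormedSpace ℂ G]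
    (R : G →ₗ.[ℂ] G) : Prop :=
  ∃ E : Set ℂ → (G →L[ℂ] G), SpectralMeasure.IsResolution R E

open Classical in
/-- The Borel functional calculus `f(R) = f(E)` of a scalar type spectral operator `R`, where `E` is
its resolution of the identity (which is unique on Borel sets). The value for an `R` that is not
scalar type spectral is a dummy. -/
noncomputable def borelCalculus {G : Type*} [NormedAddCommGroup G] [NormedSpace ℂ G]
    (R : G →ₗ.[ℂ] G) (f : ℂ → ℂ) : G →ₗ.[ℂ] G :=
  if h : IsScalarTypeSpectral R then SpectralMeasure.calculus h.choose f else ⊥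

/-!
Write `T = ∫ z dE`. The image of `E` under `z ↦ t z` is a resolution of the identity of `t T`;
since the resolution of a bounded operator is unique, `F(tT)` is the integral of `z ↦ F (t z)` with
respect to `E`. Uniqueness is a case of Fuglede's theorem: if `S` commutes with `T` and `E`, `E'`
are resolutions of `T`, then `X = E' s' * S * E s` vanishes when `|z - a| ≤ r` on `s'` and
`|z - a| ≥ R > r` on `s`, because `X = P ^ n * X * Q ^ n` with `P ^ n` of order `r ^ n` and `Q ^ n`
of order `R⁻¹ ^ n`.

The support of `E` lies in the spectrum of `T`, hence is compact, and integration against `E` is a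
bounded homomorphism from the continuous functions on the support. It therefore suffices to
differentiate and integrate the curve `t ↦ F (t ·)` in the sup norm, where pointwise derivatives
that depend continuously on `t` are enough.
-/

namespace IsSpectralMeasure

variable {G : Type*} [NormedAddCommGroup G] [NormedSpace ℂ G] {E : Set ℂ → (G →L[ℂ] G)}
  {s t : Set ℂ}

theorem apply_union_of_disjoint (hE : IsSpectralMeasure E) (hs : MeasurableSet s)
    (ht : MeasurableSet t) (hd : Disjoint s t) : E (s ∪ t) = E s + E t := by
  rw [hE.union s t hs ht, ← hE.inter s t hs ht, hd.inter_eq, hE.empty, sub_zero]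

theorem apply_biUnion_finset (hE : IsSpectralMeasure E) {ι : Type*} (S : Finset ι)
    {s : ι → Set ℂ} (hs : ∀ i, MeasurableSet (s i))
    (hd : Pairwise fun i j => Disjoint (s i) (s j)) : E (⋃ i ∈ S, s i) = ∑ i ∈ S, E (s i) := by
  classical
  induction S using Finset.induction_on with
  | empty => simp [hE.empty]
  | insert a S ha ih =>
    have hdisj : Disjoint (s a) (⋃ i ∈ S, s i) :=
      Set.disjoint_iUnion₂_right.mpr fun i hi => hd (ne_of_mem_of_not_mem hi ha).symm
    rw [Finset.set_biUnion_insert, hE.apply_union_of_disjoint (hs a)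
      (S.measurableSet_biUnion fun i _ => hs i) hdisj, ih, Finset.sum_insert ha]

theorem apply_compl (hE : IsSpectralMeasure E) (hs : MeasurableSet s) : E sᶜ = 1 - E s := by
  rw [eq_sub_iff_add_eq', ← hE.apply_union_of_disjoint hs hs.compl disjoint_compl_right,
    Set.union_compl_self, hE.univ]

theorem apply_compl_eq_zero_iff (hE : IsSpectralMeasure E) (hs : MeasurableSet s) :
    E sᶜ = 0 ↔ E s = 1 := by
  rw [hE.apply_compl hs, sub_eq_zero, eq_comm]

theorem mul_of_subset (hE : IsSpectralMeasure E) (hs : MeasurableSet s) (ht : MeasurableSet t)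
    (hst : s ⊆ t) : E s * E t = E s := by
  rw [← hE.inter s t hs ht, Set.inter_eq_left.mpr hst]

theorem mul_of_subset' (hE : IsSpectralMeasure E) (hs : MeasurableSet s) (ht : MeasurableSet t)
    (hst : s ⊆ t) : E t * E s = E s := by
  rw [← hE.inter t s ht hs, Set.inter_eq_right.mpr hst]

theorem apply_eq_one_of_subset (hE : IsSpectralMeasure E) (hs : MeasurableSet s)
    (ht : MeasurableSet t) (hst : s ⊆ t) (h : E s = 1) : E t = 1 := by
  have hmul := hE.mul_of_subset hs ht hst
  rwa [h, one_mul] at hmul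

theorem mul_apply_iUnion_mul_eq_zero_of_disjoint (hE : IsSpectralMeasure E) {A B : G →L[ℂ] G}
    {s : ℕ → Set ℂ} (hs : ∀ n, MeasurableSet (s n)) (hd : Pairwise fun m n => Disjoint (s m) (s n))
    (h : ∀ n, A * E (s n) * B = 0) : A * E (⋃ n, s n) * B = 0 := by
  ext x
  refine (SeparatingDual.eq_iff_forall_dual_eq (R := ℂ)).mpr fun φ => ?_
  have hsum := hE.weak_countably_additive s hs hd (B x) (φ ∘L A)
  have hzero n : (φ ∘L A) (E (s n) (B x)) = 0 :=
    (congrArg φ (DFunLike.congr_fun (h n) x)).trans (map_zero φ)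
  simp only [hzero] at hsum
  exact (hsum.unique hasSum_zero).trans (map_zero φ).symm

theorem apply_iUnion_mul_eq_zero (hE : IsSpectralMeasure E) {ι : Type*} [Countable ι]
    {B : G →L[ℂ] G} {s : ι → Set ℂ} (hs : ∀ i, MeasurableSet (s i)) (h : ∀ i, E (s i) * B = 0) :
    E (⋃ i, s i) * B = 0 := by
  rcases isEmpty_or_nonempty ι with hι | hι
  · rw [Set.iUnion_of_empty, hE.empty, zero_mul]
  obtain ⟨e, he⟩ := exists_surjective_nat ι
  have hdm n : MeasurableSet (disjointed (s ∘ e) n) := .disjointed (fun n => hs (e n)) n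
  have hzero n : 1 * E (disjointed (s ∘ e) n) * B = 0 := by
    rw [one_mul, ← hE.mul_of_subset (hdm n) (hs (e n)) (disjointed_subset (s ∘ e) n), mul_assoc, h,
      mul_zero]
  simpa [iUnion_disjointed, he.iUnion_comp s] using
    hE.mul_apply_iUnion_mul_eq_zero_of_disjoint hdm (disjoint_disjointed _) hzero

theorem mul_apply_iUnion_eq_zero (hE : IsSpectralMeasure E) {ι : Type*} [Countable ι]
    {A : G →L[ℂ] G} {s : ι → Set ℂ} (hs : ∀ i, MeasurableSet (s i)) (h : ∀ i, A * E (s i) = 0) :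
    A * E (⋃ i, s i) = 0 := by
  rcases isEmpty_or_nonempty ι with hι | hι
  · rw [Set.iUnion_of_empty, hE.empty, mul_zero]
  obtain ⟨e, he⟩ := exists_surjective_nat ι
  have hdm n : MeasurableSet (disjointed (s ∘ e) n) := .disjointed (fun n => hs (e n)) n
  have hzero n : A * E (disjointed (s ∘ e) n) * 1 = 0 := by
    rw [mul_one, ← hE.mul_of_subset' (hdm n) (hs (e n)) (disjointed_subset (s ∘ e) n), ← mul_assoc,
      h, zero_mul]
  simpa [iUnion_disjointed, he.iUnion_comp s] using
    hE.mul_apply_iUnion_mul_eq_zero_of_disjoint hdm (disjoint_disjointed _) hzero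

theorem apply_iUnion_eq_zero (hE : IsSpectralMeasure E) {ι : Type*} [Countable ι] {s : ι → Set ℂ}
    (hs : ∀ i, MeasurableSet (s i)) (h : ∀ i, E (s i) = 0) : E (⋃ i, s i) = 0 := by
  simpa using hE.apply_iUnion_mul_eq_zero (B := 1) hs (by simpa using h)

/-- The complex measure `s ↦ φ (E s x)`; like every vector measure, it is `0` on the sets that are
not measurable. -/
noncomputable def scalarMeasure (hE : IsSpectralMeasure E) (x : G) (φ : StrongDual ℂ G) :
    VectorMeasure ℂ ℂ := by
  classical
  exact
  { measureOf' := fun s => if MeasurableSet s then φ (E s x) else 0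
    empty' := by simp [hE.empty]
    not_measurable' := fun s hs => by simp [hs]
    m_iUnion' := fun s hs hd => by
      simp only [hs, MeasurableSet.iUnion hs, if_true]
      exact hE.weak_countably_additive s hs hd x φ }

theorem scalarMeasure_apply (hE : IsSpectralMeasure E) (x : G) (φ : StrongDual ℂ G)
    (hs : MeasurableSet s) : hE.scalarMeasure x φ s = φ (E s x) :=
  if_pos hs

-- The uniform boundedness principle is used twice: for the functionals `E s x` on the dual of `G`,
-- and then for the operators `E s`.
theorem exists_norm_apply_le [CompleteSpace G] (hE : IsSpectralMeasure E) :
    ∃ M, 0 ≤ M ∧ ∀ s, MeasurableSet s → ‖E s‖ ≤ M := by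
  have hpointwise (x : G) : ∃ C, ∀ s : {s : Set ℂ // MeasurableSet s}, ‖E s x‖ ≤ C := by
    obtain ⟨C, hC⟩ := banach_steinhaus
      (g := fun s : {s : Set ℂ // MeasurableSet s} =>
        NormedSpace.inclusionInDoubleDual ℂ G (E s x)) fun φ =>
      ⟨(hE.scalarMeasure x φ).bound, fun s => by
        rw [NormedSpace.dual_def, ← hE.scalarMeasure_apply x φ s.2]
        exact (hE.scalarMeasure x φ).norm_apply_le_bound⟩
    exact ⟨C, fun s => ((NormedSpace.inclusionInDoubleDualLi ℂ).norm_map (E s x)).ge.trans (hC s)⟩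
  obtain ⟨C, hC⟩ := banach_steinhaus hpointwise
  exact ⟨C, (norm_nonneg _).trans (hC ⟨∅, .empty⟩), fun s hs => hC ⟨s, hs⟩⟩

end IsSpectralMeasure

theorem sum_abs_le_of_abs_subset_sum_le {ι : Type*} (S : Finset ι) (a : ι → ℝ) {M : ℝ}
    (h : ∀ S' ⊆ S, |∑ i ∈ S', a i| ≤ M) : ∑ i ∈ S, |a i| ≤ 2 * M := by
  classical
  have hpos : ∑ i ∈ S with 0 ≤ a i, |a i| ≤ M := by
    rw [Finset.sum_congr rfl fun i hi => abs_of_nonneg (Finset.mem_filter.mp hi).2]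
    exact (le_abs_self _).trans (h _ (Finset.filter_subset _ S))
  have hneg : ∑ i ∈ S with ¬ 0 ≤ a i, |a i| ≤ M := by
    rw [Finset.sum_congr rfl fun i hi => abs_of_neg (not_le.mp (Finset.mem_filter.mp hi).2),
      Finset.sum_neg_distrib]
    exact (neg_le_abs _).trans (h _ (Finset.filter_subset _ S))
  rw [← Finset.sum_filter_add_sum_filter_not S (fun i => 0 ≤ a i)]
  linarith

theorem sum_norm_le_of_norm_subset_sum_le {ι : Type*} (S : Finset ι) (a : ι → ℂ) {M : ℝ}
    (h : ∀ S' ⊆ S, ‖∑ i ∈ S', a i‖ ≤ M) : ∑ i ∈ S, ‖a i‖ ≤ 4 * M := by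
  have hre : ∑ i ∈ S, |(a i).re| ≤ 2 * M := sum_abs_le_of_abs_subset_sum_le S _ fun S' hS' => by
    simpa using (Complex.abs_re_le_norm _).trans (h S' hS')
  have him : ∑ i ∈ S, |(a i).im| ≤ 2 * M := sum_abs_le_of_abs_subset_sum_le S _ fun S' hS' => by
    simpa using (Complex.abs_im_le_norm _).trans (h S' hS')
  calc ∑ i ∈ S, ‖a i‖ ≤ ∑ i ∈ S, (|(a i).re| + |(a i).im|) :=
        Finset.sum_le_sum fun i _ => Complex.norm_le_abs_re_add_abs_im (a i)
    _ ≤ 4 * M := by rw [Finset.sum_add_distrib]; linarith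

theorem exists_simpleFunc_dist_lt {α X : Type*} [MeasurableSpace α] [PseudoMetricSpace X]
    [MeasurableSpace X] [OpensMeasurableSpace X] {f : α → X} (hf : Measurable f)
    (hrange : TotallyBounded (Set.range f)) {ε : ℝ} (hε : 0 < ε) :
    ∃ s : SimpleFunc α X, ∀ a, dist (s a) (f a) < ε := by
  rcases isEmpty_or_nonempty α with hα | ⟨⟨a₀⟩⟩
  · exact ⟨.ofIsEmpty, isEmptyElim⟩
  obtain ⟨t, ht, hcover⟩ := Metric.totallyBounded_iff.mp hrange ε hε
  have hnear a : ∃ y ∈ t, dist (f a) y < ε := by simpa using hcover (Set.mem_range_self a)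
  obtain ⟨e, rfl⟩ := ht.countable.exists_eq_range ((hnear a₀).imp fun _ h => h.1)
  choose! k hk using fun y (hy : y ∈ Set.range e) => hy
  obtain ⟨N, hN⟩ := (ht.image k).bddAbove
  refine ⟨(SimpleFunc.nearestPt e N).comp f hf, fun a => ?_⟩
  obtain ⟨y, hy, hlt⟩ := hnear a
  have hle := SimpleFunc.edist_nearestPt_le e (f a) (hN (Set.mem_image_of_mem k hy))
  rw [hk y hy, edist_dist, edist_dist, ENNReal.ofReal_le_ofReal_iff dist_nonneg] at hle
  exact hle.trans_lt (dist_comm y (f a) ▸ hlt)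

namespace SpectralMeasure

variable {G : Type*} [NormedAddCommGroup G] [NormedSpace ℂ G] {E : Set ℂ → (G →L[ℂ] G)}

theorem pairwise_disjoint_preimage_singleton {α β : Type*} (g : α → β) :
    Pairwise fun i j => Disjoint (g ⁻¹' {i}) (g ⁻¹' {j}) := fun _ _ hij =>
  (Set.disjoint_singleton.mpr hij).preimage g

theorem simpleIntegral_map (hE : IsSpectralMeasure E) {α : Type*} (g : SimpleFunc ℂ α)
    (h : α → ℂ) {S : Finset α} (hS : g.range ⊆ S) :
    simpleIntegral E (g.map h) = ∑ a ∈ S, h a • E (g ⁻¹' {a}) := by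
  classical
  have hfiber (c : ℂ) : E (g.map h ⁻¹' {c}) = ∑ a ∈ g.range with h a = c, E (g ⁻¹' {a}) := by
    have hpre : g.map h ⁻¹' {c} = ⋃ a ∈ g.range.filter (fun a => h a = c), g ⁻¹' {a} := by
      ext z
      simp
    rw [hpre, hE.apply_biUnion_finset _ (fun a => g.measurableSet_fiber a)
      (pairwise_disjoint_preimage_singleton g)]
  calc simpleIntegral E (g.map h)
      = ∑ c ∈ g.range.image h, ∑ a ∈ g.range with h a = c, h a • E (g ⁻¹' {a}) := by
        rw [simpleIntegral, SimpleFunc.range_map]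
        refine Finset.sum_congr rfl fun c _ => ?_
        rw [hfiber, Finset.smul_sum]
        exact Finset.sum_congr rfl fun a ha => by rw [(Finset.mem_filter.mp ha).2]
    _ = ∑ a ∈ g.range, h a • E (g ⁻¹' {a}) :=
        Finset.sum_fiberwise_of_maps_to (fun a ha => Finset.mem_image_of_mem h ha) _
    _ = ∑ a ∈ S, h a • E (g ⁻¹' {a}) := Finset.sum_subset hS fun a _ ha => by
        rw [(SimpleFunc.preimage_eq_empty_iff g a).mpr ha, hE.empty, smul_zero]

theorem simpleIntegral_add (hE : IsSpectralMeasure E) (s t : SimpleFunc ℂ ℂ) :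
    simpleIntegral E (s + t) = simpleIntegral E s + simpleIntegral E t := by
  calc simpleIntegral E (s + t)
      = ∑ p ∈ (s.pair t).range, (p.1 + p.2) • E (s.pair t ⁻¹' {p}) := by
        rw [SimpleFunc.add_eq_map₂, simpleIntegral_map hE _ _ subset_rfl]
    _ = simpleIntegral E ((s.pair t).map Prod.fst)
          + simpleIntegral E ((s.pair t).map Prod.snd) := by
        simp only [simpleIntegral_map hE _ _ subset_rfl, ← Finset.sum_add_distrib, add_smul]
    _ = simpleIntegral E s + simpleIntegral E t := by
        rw [SimpleFunc.map_fst_pair, SimpleFunc.map_snd_pair]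

theorem simpleIntegral_mul (hE : IsSpectralMeasure E) (s t : SimpleFunc ℂ ℂ) :
    simpleIntegral E (s * t) = simpleIntegral E s * simpleIntegral E t := by
  have hrange : (s.pair t).range ⊆ s.range ×ˢ t.range := by
    intro p hp
    obtain ⟨z, rfl⟩ := SimpleFunc.mem_range.mp hp
    simp
  have hfiber (a b : ℂ) : E (s.pair t ⁻¹' {(a, b)}) = E (s ⁻¹' {a}) * E (t ⁻¹' {b}) := by
    rw [← hE.inter _ _ (s.measurableSet_fiber a) (t.measurableSet_fiber b),
      ← SimpleFunc.pair_preimage, Set.singleton_prod_singleton]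
  rw [SimpleFunc.mul_eq_map₂, simpleIntegral_map hE _ _ hrange, simpleIntegral, simpleIntegral,
    Finset.sum_mul_sum, Finset.sum_product]
  simp only [hfiber, smul_mul_smul_comm]

theorem simpleIntegral_piecewise_one_zero (hE : IsSpectralMeasure E) {s : Set ℂ}
    (hs : MeasurableSet s) :
    simpleIntegral E (.piecewise s hs (.const ℂ 1) (.const ℂ 0)) = E s := by
  classical
  set χ : SimpleFunc ℂ ℂ := .piecewise s hs (.const ℂ 1) (.const ℂ 0)
  have hrange : χ.range ⊆ {1, 0} := by
    intro a ha
    obtain ⟨z, rfl⟩ := SimpleFunc.mem_range.mp ha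
    by_cases hz : z ∈ s <;> simp [χ, hz]
  have hfiber : χ ⁻¹' {1} = s := by
    ext z
    by_cases hz : z ∈ s <;> simp [χ, hz]
  calc simpleIntegral E χ = ∑ a ∈ {1, 0}, a • E (χ ⁻¹' {a}) := simpleIntegral_map hE χ id hrange
    _ = E s := by
      rw [Finset.sum_pair one_ne_zero, zero_smul, add_zero, one_smul, hfiber]

-- The finite additivity of `E` bounds the total variation of the measures `s ↦ φ (E s x)`.
theorem norm_simpleIntegral_le (hE : IsSpectralMeasure E) {M : ℝ} (hM0 : 0 ≤ M)
    (hM : ∀ s, MeasurableSet s → ‖E s‖ ≤ M) (s : SimpleFunc ℂ ℂ) {c : ℝ} (hc : ∀ z, ‖s z‖ ≤ c) :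
    ‖simpleIntegral E s‖ ≤ 4 * M * c := by
  have hc0 : 0 ≤ c := (norm_nonneg _).trans (hc 0)
  refine ContinuousLinearMap.opNorm_le_bound _ (by positivity) fun x => ?_
  refine NormedSpace.norm_le_dual_bound ℂ _ (by positivity) fun φ => ?_
  have hvariation : ∑ a ∈ s.range, ‖φ (E (s ⁻¹' {a}) x)‖ ≤ 4 * (‖φ‖ * (M * ‖x‖)) := by
    refine sum_norm_le_of_norm_subset_sum_le _ _ fun S' _ => ?_
    have hunion : ∑ a ∈ S', φ (E (s ⁻¹' {a}) x) = φ (E (⋃ a ∈ S', s ⁻¹' {a}) x) := by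
      rw [hE.apply_biUnion_finset S' (fun a => s.measurableSet_fiber a)
        (pairwise_disjoint_preimage_singleton s)]
      simp
    rw [hunion]
    exact φ.le_opNorm_of_le (ContinuousLinearMap.le_of_opNorm_le _
      (hM _ (S'.measurableSet_biUnion fun a _ => s.measurableSet_fiber a)) x)
  calc ‖φ (simpleIntegral E s x)‖ = ‖∑ a ∈ s.range, a * φ (E (s ⁻¹' {a}) x)‖ := by
        simp [simpleIntegral]
    _ ≤ ∑ a ∈ s.range, c * ‖φ (E (s ⁻¹' {a}) x)‖ := norm_sum_le_of_le _ fun a ha => by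
        obtain ⟨z, rfl⟩ := SimpleFunc.mem_range.mp ha
        rw [norm_mul]
        gcongr
        exact hc z
    _ ≤ c * (4 * (‖φ‖ * (M * ‖x‖))) := by
        rw [← Finset.mul_sum]
        gcongr
    _ = 4 * M * c * ‖x‖ * ‖φ‖ := by ring

end SpectralMeasure

theorem tendstoUniformly_mul_of_bounded {α ι R : Type*} [NonUnitalSeminormedRing R] [ProperSpace R]
    {l : Filter ι} {s t : ι → α → R} {f g : α → R} (hs : TendstoUniformly s f l)
    (ht : TendstoUniformly t g l) {C D : ℝ} (hf : ∀ x, ‖f x‖ ≤ C) (hg : ∀ x, ‖g x‖ ≤ D) :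
    TendstoUniformly (fun n => s n * t n) (f * g) l := by
  have hbound {s : ι → α → R} {f : α → R} (hs : TendstoUniformly s f l) {C : ℝ}
      (hf : ∀ x, ‖f x‖ ≤ C) : ∀ᶠ n in l, ∀ x, ‖s n x‖ ≤ C + 1 := by
    filter_upwards [Metric.tendstoUniformly_iff.mp hs 1 one_pos] with n hn x
    linarith [norm_le_norm_add_norm_sub (f x) (s n x), hf x, dist_eq_norm (f x) (s n x), hn x]
  have hmul : UniformContinuousOn (fun p : R × R => p.1 * p.2)
      (Metric.closedBall 0 (C + 1) ×ˢ Metric.closedBall 0 (D + 1)) :=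
    ((isCompact_closedBall _ _).prod (isCompact_closedBall _ _)).uniformContinuousOn_of_continuous
      continuous_mul.continuousOn
  refine hmul.comp_tendstoUniformly_eventually (F := fun n x => (s n x, t n x))
    (f := fun x => (f x, g x)) ?_ (fun x => ?_) fun u hu => (hs.prodMk ht u hu).diag_of_prod
  · filter_upwards [hbound hs hf, hbound ht hg] with n hsn htn x
    simpa using ⟨hsn x, htn x⟩
  · simpa using ⟨(hf x).trans (by linarith), (hg x).trans (by linarith)⟩

namespace SpectralMeasure

variable {G : Type*} [NormedAddCommGroup G] [NormedSpace ℂ G] {E : Set ℂ → (G →L[ℂ] G)}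
  {f g : ℂ → ℂ} {A B : G →L[ℂ] G} {s : Set ℂ}

namespace HasSpectralIntegral

theorem of_simpleFunc (s : SimpleFunc ℂ ℂ) : HasSpectralIntegral E s (simpleIntegral E s) :=
  ⟨fun _ => s, fun _ hu => .of_forall fun _ _ => refl_mem_uniformity hu, tendsto_const_nhds⟩

theorem indicator_one (hE : IsSpectralMeasure E) (hs : MeasurableSet s) :
    HasSpectralIntegral E (s.indicator 1) (E s) := by
  have h := of_simpleFunc (E := E) (.piecewise s hs (.const ℂ 1) (.const ℂ 0))
  rw [simpleIntegral_piecewise_one_zero hE hs] at h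
  convert h using 1
  ext z
  by_cases hz : z ∈ s <;> simp [hz]

theorem one (hE : IsSpectralMeasure E) : HasSpectralIntegral E 1 1 := by
  simpa only [hE.univ, Set.indicator_univ] using indicator_one hE .univ

theorem measurable (hf : HasSpectralIntegral E f A) : Measurable f := by
  obtain ⟨s, hs, -⟩ := hf
  exact measurable_of_tendsto_metrizable (fun n => (s n).measurable)
    (tendsto_pi_nhds.mpr hs.tendsto_at)

theorem exists_norm_le (hf : HasSpectralIntegral E f A) : ∃ C, ∀ z, ‖f z‖ ≤ C := by
  obtain ⟨s, hs, -⟩ := hf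
  obtain ⟨n, hn⟩ := (Metric.tendstoUniformly_iff.mp hs 1 one_pos).exists
  obtain ⟨C, hC⟩ := (s n).exists_forall_norm_le
  refine ⟨C + 1, fun z => (norm_le_norm_add_norm_sub (s n z) (f z)).trans (add_le_add (hC z) ?_)⟩
  rw [norm_sub_rev, ← dist_eq_norm]
  exact (hn z).le

theorem add (hE : IsSpectralMeasure E) (hf : HasSpectralIntegral E f A)
    (hg : HasSpectralIntegral E g B) : HasSpectralIntegral E (f + g) (A + B) := by
  obtain ⟨s, hs, hs'⟩ := hf
  obtain ⟨t, ht, ht'⟩ := hg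
  refine ⟨fun n => s n + t n, hs.add ht, ?_⟩
  simpa only [simpleIntegral_add hE] using hs'.add ht'

theorem mul (hE : IsSpectralMeasure E) (hf : HasSpectralIntegral E f A)
    (hg : HasSpectralIntegral E g B) : HasSpectralIntegral E (f * g) (A * B) := by
  obtain ⟨C, hC⟩ := hf.exists_norm_le
  obtain ⟨D, hD⟩ := hg.exists_norm_le
  obtain ⟨s, hs, hs'⟩ := hf
  obtain ⟨t, ht, ht'⟩ := hg
  refine ⟨fun n => s n * t n, tendstoUniformly_mul_of_bounded hs ht hC hD, ?_⟩
  simpa only [simpleIntegral_mul hE] using hs'.mul ht'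

theorem pow (hE : IsSpectralMeasure E) (hf : HasSpectralIntegral E f A) (n : ℕ) :
    HasSpectralIntegral E (f ^ n) (A ^ n) := by
  induction n with
  | zero => simpa only [pow_zero] using one hE
  | succ n ih => simpa only [pow_succ] using ih.mul hE hf

theorem const (hE : IsSpectralMeasure E) (c : ℂ) :
    HasSpectralIntegral E (fun _ => c) (c • 1) := by
  have h := of_simpleFunc (E := E) (.const ℂ c)
  have hfiber : SimpleFunc.const ℂ c ⁻¹' {c} = Set.univ := Set.eq_univ_of_forall fun _ => rfl
  rwa [simpleIntegral, SimpleFunc.range_const, Finset.sum_singleton, hfiber, hE.univ] at h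

theorem smul (hE : IsSpectralMeasure E) (hf : HasSpectralIntegral E f A) (c : ℂ) :
    HasSpectralIntegral E (c • f) (c • A) := by
  have h := (const hE c).mul hE hf
  rwa [smul_one_mul] at h

theorem sub (hE : IsSpectralMeasure E) (hf : HasSpectralIntegral E f A)
    (hg : HasSpectralIntegral E g B) : HasSpectralIntegral E (f - g) (A - B) := by
  simpa only [sub_eq_add_neg, neg_one_smul] using hf.add hE (hg.smul hE (-1))

theorem indicator (hE : IsSpectralMeasure E) (hf : HasSpectralIntegral E f A)
    (hs : MeasurableSet s) : HasSpectralIntegral E (s.indicator f) (A * E s) := by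
  have hmul : s.indicator f = f * s.indicator 1 := funext fun z => by
    simpa using Set.indicator_mul_right s f 1 (i := z)
  exact hmul ▸ hf.mul hE (indicator_one hE hs)

end HasSpectralIntegral

variable [CompleteSpace G]

theorem exists_norm_integral_le (hE : IsSpectralMeasure E) : ∃ C, 0 ≤ C ∧ ∀ {f : ℂ → ℂ}
    {A : G →L[ℂ] G} {c : ℝ}, HasSpectralIntegral E f A → (∀ z, ‖f z‖ ≤ c) → ‖A‖ ≤ C * c := by
  obtain ⟨M, hM0, hM⟩ := hE.exists_norm_apply_le
  refine ⟨4 * M, by positivity, fun {f A c} ⟨s, hs, hs'⟩ hc => ?_⟩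
  have hnear : ∀ ε > 0, ‖A‖ ≤ 4 * M * (c + ε) := fun ε hε => by
    refine le_of_tendsto hs'.norm ?_
    filter_upwards [Metric.tendstoUniformly_iff.mp hs ε hε] with n hn
    refine norm_simpleIntegral_le hE hM0 hM (s n) fun z => ?_
    linarith [norm_le_norm_add_norm_sub' (s n z) (f z), hc z, dist_eq_norm (s n z) (f z),
      dist_comm (s n z) (f z), hn z]
  have hlim : Tendsto (fun ε => 4 * M * (c + ε)) (𝓝[>] 0) (𝓝 (4 * M * c)) := by
    have hcont : Continuous fun ε => 4 * M * (c + ε) := by fun_prop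
    simpa using (hcont.tendsto 0).mono_left nhdsWithin_le_nhds
  exact ge_of_tendsto hlim (eventually_mem_nhdsWithin.mono hnear)

theorem HasSpectralIntegral.unique (hE : IsSpectralMeasure E) (hA : HasSpectralIntegral E f A)
    (hB : HasSpectralIntegral E f B) : A = B := by
  obtain ⟨C, -, hC⟩ := exists_norm_integral_le hE
  have hnorm : ‖A - B‖ ≤ C * 0 := hC (hA.sub hE hB) fun z => by simp
  rwa [mul_zero, norm_le_zero_iff, sub_eq_zero] at hnorm

theorem HasSpectralIntegral.spectralIntegral_eq (hE : IsSpectralMeasure E)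
    (hf : HasSpectralIntegral E f A) : spectralIntegral E f = A := by
  have h : ∃ A, HasSpectralIntegral E f A := ⟨A, hf⟩
  rw [spectralIntegral, dif_pos h]
  exact h.choose_spec.unique hE hf

theorem HasSpectralIntegral.commute (hE : IsSpectralMeasure E) (hf : HasSpectralIntegral E f A)
    (hg : HasSpectralIntegral E g B) : Commute A B :=
  (hf.mul hE hg).unique hE (mul_comm g f ▸ hg.mul hE hf)

theorem cauchySeq_simpleIntegral (hE : IsSpectralMeasure E) {s : ℕ → SimpleFunc ℂ ℂ}
    (hs : TendstoUniformly (fun n z => s n z) f atTop) :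
    CauchySeq fun n => simpleIntegral E (s n) := by
  obtain ⟨C, hC0, hC⟩ := exists_norm_integral_le hE
  refine Metric.cauchySeq_iff'.mpr fun ε hε => ?_
  obtain ⟨N, hN⟩ := eventually_atTop.mp
    (Metric.tendstoUniformly_iff.mp hs (ε / (2 * C + 1) / 2) (by positivity))
  refine ⟨N, fun n hn => ?_⟩
  have hdist z : ‖s n z - s N z‖ ≤ ε / (2 * C + 1) := by
    rw [← dist_eq_norm]
    linarith [dist_triangle_left (s n z) (s N z) (f z), hN n hn z, hN N le_rfl z]
  have hnorm := hC ((HasSpectralIntegral.of_simpleFunc (s n)).sub hE (.of_simpleFunc (s N))) hdist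
  calc dist (simpleIntegral E (s n)) (simpleIntegral E (s N)) ≤ C * (ε / (2 * C + 1)) := by
        rwa [dist_eq_norm]
    _ < ε := by
        rw [mul_div_assoc', div_lt_iff₀ (by positivity)]
        nlinarith

theorem hasSpectralIntegral_of_bounded (hE : IsSpectralMeasure E) (hf : Measurable f)
    (hbdd : ∃ C, ∀ z, ‖f z‖ ≤ C) : HasSpectralIntegral E f (spectralIntegral E f) := by
  obtain ⟨D, hD⟩ := hbdd
  have hrange : TotallyBounded (Set.range f) := (isCompact_closedBall 0 D).totallyBounded.subset
    (Set.range_subset_iff.mpr fun z => mem_closedBall_zero_iff.mpr (hD z))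
  choose s hs using fun n : ℕ =>
    exists_simpleFunc_dist_lt hf hrange (Nat.one_div_pos_of_nat (α := ℝ) (n := n))
  have hlim : TendstoUniformly (fun n z => s n z) f atTop :=
    Metric.tendstoUniformly_iff.mpr fun ε hε => by
      filter_upwards [(tendsto_one_div_add_atTop_nhds_zero_nat (𝕜 := ℝ)).eventually_lt_const hε]
        with n hn z
      rw [dist_comm]
      exact (hs n z).trans hn
  obtain ⟨A, hA⟩ := cauchySeq_tendsto_of_complete (cauchySeq_simpleIntegral hE hlim)
  have hfA : HasSpectralIntegral E f A := ⟨s, hlim, hA⟩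
  rwa [hfA.spectralIntegral_eq hE]

end SpectralMeasure

theorem norm_indicator_le_of_forall_mem {α F : Type*} [SeminormedAddCommGroup F] {s : Set α}
    {f : α → F} {c : ℝ} (hc : 0 ≤ c) (h : ∀ a ∈ s, ‖f a‖ ≤ c) (a : α) : ‖s.indicator f a‖ ≤ c := by
  rw [norm_indicator_eq_indicator_norm]
  exact Set.indicator_le' (g := fun _ => c) h (fun _ _ => hc) a

namespace SpectralMeasure

variable {G : Type*} [NormedAddCommGroup G] [NormedSpace ℂ G] {E : Set ℂ → (G →L[ℂ] G)}
  {f g : ℂ → ℂ} {A B T : G →L[ℂ] G} {s : Set ℂ}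

theorem isClosed_supp : IsClosed (supp E) :=
  isClosed_biInter fun _ _ => isClosed_closure

theorem measurableSet_supp : MeasurableSet (supp E) :=
  isClosed_supp.measurableSet

theorem supp_subset {C : Set ℂ} (hC : IsClosed C) (h : E C = 1) : supp E ⊆ C :=
  fun _ hz => hC.closure_subset (Set.mem_iInter₂.mp hz C ⟨hC.measurableSet, h⟩)

-- The complement of the support is a union of open null sets, so by the Lindelöf property it is a
-- countable union of null sets.
theorem apply_supp (hE : IsSpectralMeasure E) : E (supp E) = 1 := by
  rw [← hE.apply_compl_eq_zero_iff measurableSet_supp]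
  obtain ⟨S, hS, hScount, hSunion⟩ := TopologicalSpace.isOpen_biUnion_countable
    {s : Set ℂ | MeasurableSet s ∧ E s = 1} (fun s => (closure s)ᶜ)
    fun _ _ => isClosed_closure.isOpen_compl
  have hcompl : (supp E)ᶜ = ⋃ s ∈ S, (closure s)ᶜ := by
    simp only [hSunion, supp, Set.compl_iInter]
  have : Countable S := hScount.to_subtype
  rw [hcompl, Set.biUnion_eq_iUnion]
  refine hE.apply_iUnion_eq_zero (fun s => isClosed_closure.measurableSet.compl) fun s => ?_
  obtain ⟨hmeas, hone⟩ := hS s.2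
  exact (hE.apply_compl_eq_zero_iff isClosed_closure.measurableSet).mpr
    (hE.apply_eq_one_of_subset hmeas isClosed_closure.measurableSet subset_closure hone)

theorem apply_supp_inter (hE : IsSpectralMeasure E) (hs : MeasurableSet s) :
    E (supp E ∩ s) = E s := by
  rw [hE.inter _ _ measurableSet_supp hs, apply_supp hE, one_mul]

theorem calculus_eq_everywhere_iff : calculus E f = A.everywhere ↔
    ∀ x, Tendsto (fun n => spectralIntegral E (trunc E f n) x) atTop (𝓝 (A x)) := by
  constructor
  · intro h x
    have hx : x ∈ (calculus E f).domain := by rw [h]; trivial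
    have hval : calculus E f ⟨x, hx⟩ = A x :=
      @(LinearPMap.ext_iff.mp h).2 x hx (show x ∈ A.everywhere.domain from trivial)
    exact hval ▸ hx.choose_spec
  · refine fun h => LinearPMap.ext ?_ fun x hx _ => tendsto_nhds_unique hx.choose_spec (h x)
    ext x
    exact ⟨fun _ => trivial, fun _ => ⟨A x, h x⟩⟩

theorem trunc_apply {n : ℕ} {z : ℂ} (hz : z ∈ supp E) :
    trunc E f n z = {z | ‖f z‖ ≤ n}.indicator f z := by
  rw [trunc, ← Set.indicator_indicator, Set.indicator_of_mem hz]

theorem trunc_eq_indicator (n : ℕ) : trunc E f n =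
    {z | ‖(supp E).indicator f z‖ ≤ n}.indicator ((supp E).indicator f) := by
  ext z
  rw [trunc, Set.inter_comm, ← Set.indicator_indicator]
  by_cases hz : z ∈ supp E <;> simp [Set.indicator_apply, hz]

theorem measurable_trunc (hf : Measurable ((supp E).indicator f)) (n : ℕ) :
    Measurable (trunc E f n) :=
  trunc_eq_indicator (E := E) (f := f) n ▸
    hf.indicator (measurableSet_le hf.norm measurable_const)

theorem norm_trunc_le (n : ℕ) (z : ℂ) : ‖trunc E f n z‖ ≤ n :=
  norm_indicator_le_of_forall_mem n.cast_nonneg (fun _ hz => hz.2) z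

variable [CompleteSpace G]

theorem HasSpectralIntegral.unique_of_eqOn_supp (hE : IsSpectralMeasure E)
    (hf : HasSpectralIntegral E f A) (hg : HasSpectralIntegral E g B)
    (hfg : Set.EqOn f g (supp E)) : A = B := by
  have hf' := hf.indicator hE (measurableSet_supp (E := E))
  have hg' := hg.indicator hE (measurableSet_supp (E := E))
  rw [apply_supp hE, mul_one] at hf' hg'
  rw [Set.indicator_congr hfg] at hf'
  exact hf'.unique hE hg'

theorem calculus_eq_everywhere (hE : IsSpectralMeasure E) (hg : HasSpectralIntegral E g A)
    (hfg : Set.EqOn f g (supp E)) : calculus E f = A.everywhere := by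
  refine calculus_eq_everywhere_iff.mpr fun x => tendsto_const_nhds.congr' ?_
  obtain ⟨D, hD⟩ := hg.exists_norm_le
  filter_upwards [(tendsto_natCast_atTop_atTop (R := ℝ)).eventually_ge_atTop D] with n hn
  have htrunc : trunc E f n = (supp E).indicator g := by
    rw [← Set.indicator_congr hfg, trunc, Set.inter_eq_left.mpr]
    exact fun z hz => by simpa only [Set.mem_ofPred_eq, hfg hz] using (hD z).trans hn
  have hint := hg.indicator hE (measurableSet_supp (E := E))
  rw [apply_supp hE, mul_one, ← htrunc] at hint
  rw [hint.spectralIntegral_eq hE]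

theorem IsResolution.hasSpectralIntegral_indicator_id (h : IsResolution T.everywhere E)
    (hs : MeasurableSet s) (hbdd : Bornology.IsBounded s) :
    HasSpectralIntegral E (s.indicator id) (T * E s) := by
  obtain ⟨hE, hT⟩ := h
  obtain ⟨D, hD0, hD⟩ := hbdd.exists_pos_norm_le
  have hint := hasSpectralIntegral_of_bounded hE (measurable_id.indicator hs)
    ⟨D, norm_indicator_le_of_forall_mem hD0.le hD⟩
  suffices heq : T * E s = spectralIntegral E (s.indicator id) from heq ▸ hint
  ext x
  refine tendsto_nhds_unique (calculus_eq_everywhere_iff.mp hT.symm (E s x))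
    (tendsto_const_nhds.congr' ?_)
  filter_upwards [(tendsto_natCast_atTop_atTop (R := ℝ)).eventually_ge_atTop D] with n hn
  have htrunc := (hasSpectralIntegral_of_bounded hE (measurable_trunc
    (measurable_id.indicator measurableSet_supp) n) ⟨n, norm_trunc_le (E := E) n⟩).indicator hE hs
  refine DFunLike.congr_fun (hint.unique_of_eqOn_supp hE htrunc fun z hz => ?_) x
  by_cases hzs : z ∈ s
  · have hzn : z ∈ {z : ℂ | ‖id z‖ ≤ n} := (hD z hzs).trans hn
    simp only [hzs, hzn, Set.indicator_of_mem, trunc_apply hz]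
  · simp only [hzs, not_false_eq_true, Set.indicator_of_notMem]

-- If `l` is in the resolvent set, then on a small ball `b` around `l` the operator `(l - T) * E b`
-- has small norm but is inverted by the resolvent on the range of `E b`, so `E b = 0`.
theorem IsResolution.supp_subset_spectrum (h : IsResolution T.everywhere E) :
    supp E ⊆ spectrum ℂ T := by
  intro l hl
  by_contra hlT
  obtain ⟨R, hR⟩ : ∃ R : G →L[ℂ] G, R * (T - l • 1) = 1 := by
    obtain ⟨u, hu⟩ := (spectrum.notMem_iff.mp hlT).neg
    exact ⟨↑u⁻¹, by rw [← Algebra.algebraMap_eq_smul_one, ← neg_sub, ← hu]; exact u.inv_mul⟩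
  obtain ⟨C, hC0, hC⟩ := exists_norm_integral_le h.1
  obtain ⟨ε, hε, hRε⟩ : ∃ ε > 0, ‖R‖ * (C * ε) < 1 := by
    refine ⟨1 / (‖R‖ * C + 1), by positivity, ?_⟩
    rw [← mul_assoc, mul_one_div, div_lt_one (by positivity)]
    exact lt_add_one _
  let b := Metric.ball l ε
  have hb : MeasurableSet b := measurableSet_ball
  have hsmall : ‖(T - l • 1) * E b‖ ≤ C * ε := by
    have hint := (h.hasSpectralIntegral_indicator_id hb Metric.isBounded_ball).sub h.1
      ((HasSpectralIntegral.const h.1 l).indicator h.1 hb)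
    rw [← sub_mul, ← Set.indicator_sub'] at hint
    exact hC hint (norm_indicator_le_of_forall_mem hε.le fun z hz => (mem_ball_iff_norm.mp hz).le)
  have hzero : E b = 0 := by
    have hle : ‖E b‖ ≤ ‖R‖ * (C * ε) * ‖E b‖ := calc
      ‖E b‖ = ‖R * ((T - l • 1) * E b) * E b‖ := by
        rw [← mul_assoc R, hR, one_mul, h.1.proj b hb]
      _ ≤ ‖R‖ * ‖(T - l • 1) * E b‖ * ‖E b‖ :=
        (norm_mul_le _ _).trans (by gcongr; exact norm_mul_le _ _)
      _ ≤ ‖R‖ * (C * ε) * ‖E b‖ := by gcongr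
    exact norm_le_zero_iff.mp (by nlinarith [norm_nonneg (E b)])
  have hcompl : E bᶜ = 1 := by rw [h.1.apply_compl hb, hzero, sub_zero]
  exact supp_subset Metric.isOpen_ball.isClosed_compl hcompl hl (Metric.mem_ball_self hε)

theorem IsResolution.hasSpectralIntegral_id (h : IsResolution T.everywhere E) :
    HasSpectralIntegral E ((supp E).indicator id) T := by
  simpa only [apply_supp h.1, mul_one] using h.hasSpectralIntegral_indicator_id measurableSet_supp
    ((spectrum.isBounded T).subset h.supp_subset_spectrum)

end SpectralMeasure

theorem eq_zero_of_eq_mul_mul_of_norm_pow_le {R : Type*} [NormedRing R] {X P Q : R}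
    (h : X = P * X * Q) {C D r s : ℝ} (hr : 0 ≤ r) (hs : 0 ≤ s) (hrs : r * s < 1)
    (hP : ∀ n, ‖P ^ n‖ ≤ C * r ^ n) (hQ : ∀ n, ‖Q ^ n‖ ≤ D * s ^ n) : X = 0 := by
  have hiterate (n : ℕ) : X = P ^ n * X * Q ^ n := by
    induction n with
    | zero => simp
    | succ n ih => calc
        X = P ^ n * (P * X * Q) * Q ^ n := by rw [← h, ← ih]
        _ = P ^ (n + 1) * X * Q ^ (n + 1) := by rw [pow_succ, pow_succ']; simp only [mul_assoc]
  have hle (n : ℕ) : ‖X‖ ≤ C * D * ‖X‖ * (r * s) ^ n := calc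
    ‖X‖ ≤ ‖P ^ n‖ * ‖X‖ * ‖Q ^ n‖ := by
      conv_lhs => rw [hiterate n]
      exact norm_mul₃_le
    _ ≤ C * r ^ n * ‖X‖ * (D * s ^ n) := by
      gcongr
      exacts [mul_nonneg ((norm_nonneg _).trans (hP n)) (norm_nonneg X), hP n, hQ n]
    _ = C * D * ‖X‖ * (r * s) ^ n := by ring
  have hlim := (tendsto_pow_atTop_nhds_zero_of_lt_one (mul_nonneg hr hs) hrs).const_mul
    (C * D * ‖X‖)
  rw [mul_zero] at hlim
  exact norm_le_zero_iff.mp (ge_of_tendsto' hlim hle)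

namespace SpectralMeasure

variable {G : Type*} [NormedAddCommGroup G] [NormedSpace ℂ G] {E E' : Set ℂ → (G →L[ℂ] G)}
  {f f' : ℂ → ℂ} {A A' S T T' : G →L[ℂ] G}

theorem semiconjBy_apply_iff (hE : IsSpectralMeasure E) (hE' : IsSpectralMeasure E') {s : Set ℂ}
    (hs : MeasurableSet s) :
    SemiconjBy S (E s) (E' s) ↔ E' s * S * E sᶜ = 0 ∧ E' sᶜ * S * E s = 0 := by
  rw [hE.apply_compl hs, hE'.apply_compl hs, mul_sub, mul_one, sub_mul, sub_mul, one_mul,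
    sub_eq_zero, sub_eq_zero, SemiconjBy]
  refine ⟨fun h => ⟨?_, ?_⟩, fun ⟨h, h'⟩ => h'.trans h.symm⟩
  · rw [mul_assoc, h, ← mul_assoc, hE'.proj s hs]
  · rw [← h, mul_assoc, hE.proj s hs]

theorem semiconjBy_apply_of_forall_isOpen (hE : IsSpectralMeasure E) (hE' : IsSpectralMeasure E')
    (h : ∀ U, IsOpen U → SemiconjBy S (E U) (E' U)) {s : Set ℂ} (hs : MeasurableSet s) :
    SemiconjBy S (E s) (E' s) := by
  induction s, hs using MeasurableSet.induction_on_open with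
  | isOpen U hU => exact h U hU
  | compl s hs ih =>
    rw [hE.apply_compl hs, hE'.apply_compl hs]
    exact (SemiconjBy.one_right S).sub_right ih
  | iUnion s hd hs ih =>
    ext x
    refine (SeparatingDual.eq_iff_forall_dual_eq (R := ℂ)).mpr fun φ => ?_
    have hsum := hE.weak_countably_additive s hs hd x (φ ∘L S)
    have hterm n : (φ ∘L S) (E (s n) x) = φ (E' (s n) (S x)) :=
      congrArg φ (DFunLike.congr_fun (ih n) x)
    simp only [hterm] at hsum
    exact hsum.unique (hE'.weak_countably_additive s hs hd (S x) φ)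

theorem calculus_congr_spectralIntegral_trunc
    (h : ∀ n, spectralIntegral E (trunc E f n) = spectralIntegral E' (trunc E' f' n)) :
    calculus E f = calculus E' f' := by
  refine LinearPMap.ext (by simp only [calculus, h]) fun x hx hx' =>
    tendsto_nhds_unique hx.choose_spec ?_
  simp only [h]
  exact hx'.choose_spec

theorem calculus_congr_of_eqOn (h : Set.EqOn E E' {s | MeasurableSet s}) (f : ℂ → ℂ) :
    calculus E f = calculus E' f := by
  have hsupp : supp E = supp E' := by
    have hone s : MeasurableSet s ∧ E s = 1 ↔ MeasurableSet s ∧ E' s = 1 :=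
      and_congr_right fun hs => by rw [h hs]
    simp only [supp, hone]
  have hsimple : simpleIntegral E = simpleIntegral E' := funext fun s =>
    Finset.sum_congr rfl fun c _ => by rw [h (s.measurableSet_fiber c)]
  have hint : HasSpectralIntegral E = HasSpectralIntegral E' := by
    funext f A
    simp only [HasSpectralIntegral, hsimple]
  exact calculus_congr_spectralIntegral_trunc fun n => by
    rw [trunc, trunc, spectralIntegral, spectralIntegral, hsupp, hint]

variable [CompleteSpace G]

theorem exists_hasSpectralIntegral_indicator_inv (hE : IsSpectralMeasure E)
    (hf : HasSpectralIntegral E f A) {s : Set ℂ} (hs : MeasurableSet s) {R : ℝ} (hR : 0 < R)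
    (hge : ∀ z ∈ s, R ≤ ‖f z‖) :
    ∃ Q, HasSpectralIntegral E (s.indicator f⁻¹) Q ∧ A * Q = E s ∧ E s * Q = Q := by
  have hfinv : ∀ z ∈ s, ‖f⁻¹ z‖ ≤ R⁻¹ := fun z hz =>
    (norm_inv (f z)).trans_le (inv_anti₀ hR (hge z hz))
  have hQ := hasSpectralIntegral_of_bounded hE (hf.measurable.inv.indicator hs)
    ⟨_, norm_indicator_le_of_forall_mem (inv_nonneg.mpr hR.le) hfinv⟩
  have hone := HasSpectralIntegral.indicator_one hE hs
  refine ⟨_, hQ, (hf.mul hE hQ).unique hE ?_, (hone.commute hE hQ).eq.trans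
    ((hQ.indicator hE hs).unique hE ?_)⟩
  · convert hone using 1
    ext z
    by_cases hz : z ∈ s
    · simp [hz, mul_inv_cancel₀ (norm_pos_iff.mp (hR.trans_le (hge z hz)))]
    · simp [hz]
  · rwa [Set.indicator_indicator, Set.inter_self]

-- The operator `X = E' s' * S * E s` satisfies `X = P * X * Q` with `P` the integral of `f'` over
-- `s'` and `Q` the integral of `1 / f` over `s`.
theorem apply_mul_mul_apply_eq_zero (hE : IsSpectralMeasure E) (hE' : IsSpectralMeasure E')
    (hf : HasSpectralIntegral E f A) (hf' : HasSpectralIntegral E' f' A') (hS : SemiconjBy S A A')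
    {s s' : Set ℂ} (hs : MeasurableSet s) (hs' : MeasurableSet s') {r R : ℝ} (hr : 0 ≤ r)
    (hrR : r < R) (hle : ∀ z ∈ s', ‖f' z‖ ≤ r) (hge : ∀ z ∈ s, R ≤ ‖f z‖) :
    E' s' * S * E s = 0 := by
  have hR : 0 < R := hr.trans_lt hrR
  obtain ⟨Q, hQ, hAQ, hEQ⟩ := exists_hasSpectralIntegral_indicator_inv hE hf hs hR hge
  have hP := hf'.indicator hE' hs'
  have hAE : E' s' * A' = A' * E' s' := (HasSpectralIntegral.indicator_one hE' hs').commute hE' hf'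
  have hfixed : E' s' * S * E s = A' * E' s' * (E' s' * S * E s) * Q := calc
    E' s' * S * E s = E' s' * (S * A) * Q := by rw [← hAQ]; simp only [mul_assoc]
    _ = A' * (E' s' * E' s') * S * (E s * Q) := by
      rw [hS, hEQ, hE'.proj s' hs', ← hAE]
      simp only [mul_assoc]
    _ = A' * E' s' * (E' s' * S * E s) * Q := by simp only [mul_assoc]
  obtain ⟨C, -, hC⟩ := exists_norm_integral_le hE'
  obtain ⟨D, -, hD⟩ := exists_norm_integral_le hE
  refine eq_zero_of_eq_mul_mul_of_norm_pow_le hfixed hr (inv_nonneg.mpr hR.le)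
    (by rwa [← div_eq_mul_inv, div_lt_one hR])
    (fun n => hC (hP.pow hE' n) fun z => ?_) (fun n => hD (hQ.pow hE n) fun z => ?_)
  · rw [Pi.pow_apply, norm_pow]
    gcongr
    exact norm_indicator_le_of_forall_mem hr hle z
  · rw [Pi.pow_apply, norm_pow]
    gcongr
    exact norm_indicator_le_of_forall_mem (inv_nonneg.mpr hR.le)
      (fun z hz => (norm_inv (f z)).trans_le (inv_anti₀ hR (hge z hz))) z

theorem IsResolution.apply_mul_mul_apply_compl_eq_zero (h : IsResolution T.everywhere E)
    (h' : IsResolution T'.everywhere E') (hS : SemiconjBy S T T') {U : Set ℂ} (hU : IsOpen U) :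
    E' U * S * E Uᶜ = 0 := by
  choose! ε hε hεU using Metric.isOpen_iff.mp hU
  obtain ⟨t, htU, htcount, htunion⟩ := TopologicalSpace.isOpen_biUnion_countable U
    (fun z => Metric.ball z (ε z / 2)) fun _ _ => Metric.isOpen_ball
  have hcover : U = ⋃ z ∈ t, Metric.ball z (ε z / 2) := by
    rw [htunion]
    refine (Set.iUnion₂_subset fun z hz => ?_).antisymm' fun z hz => ?_
    · exact (Metric.ball_subset_ball (half_le_self (hε z hz).le)).trans (hεU z hz)
    · exact Set.mem_biUnion hz (Metric.mem_ball_self (half_pos (hε z hz)))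
  have hball : ∀ z : t, E' (Metric.ball z (ε z / 2)) * (S * E Uᶜ) = 0 := fun ⟨a, hat⟩ => by
    have ha : a ∈ U := htU hat
    have hint := h.hasSpectralIntegral_id.sub h.1 (.const h.1 a)
    have hint' := h'.hasSpectralIntegral_id.sub h'.1 (.const h'.1 a)
    have hSa : SemiconjBy S (T - a • 1) (T' - a • 1) :=
      hS.sub_right ((SemiconjBy.one_right S).smul_right a)
    rw [← mul_assoc, ← apply_supp_inter h.1 hU.measurableSet.compl,
      ← apply_supp_inter h'.1 measurableSet_ball]
    refine apply_mul_mul_apply_eq_zero h.1 h'.1 hint hint' hSa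
      (measurableSet_supp.inter hU.measurableSet.compl)
      (measurableSet_supp.inter measurableSet_ball) (half_pos (hε a ha)).le
      (half_lt_self (hε a ha)) (fun z ⟨hz, hza⟩ => ?_) fun z ⟨hz, hzU⟩ => ?_
    · simpa [hz] using (mem_ball_iff_norm.mp hza).le
    · simpa [hz, dist_eq_norm] using fun hza => hzU (hεU a ha hza)
  have : Countable t := htcount.to_subtype
  have hunion := h'.1.apply_iUnion_mul_eq_zero (fun _ => measurableSet_ball) hball
  rwa [← Set.biUnion_eq_iUnion t fun z _ => Metric.ball z (ε z / 2), ← hcover, ← mul_assoc]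
    at hunion

theorem IsResolution.semiconjBy_apply (h : IsResolution T.everywhere E)
    (h' : IsResolution T'.everywhere E') (hS : SemiconjBy S T T') {s : Set ℂ}
    (hs : MeasurableSet s) : SemiconjBy S (E s) (E' s) := by
  refine semiconjBy_apply_of_forall_isOpen h.1 h'.1 (fun U hU => ?_) hs
  refine (semiconjBy_apply_iff h.1 h'.1 hU.measurableSet).mpr
    ⟨h.apply_mul_mul_apply_compl_eq_zero h' hS hU, ?_⟩
  obtain ⟨C, hC, -, rfl, -⟩ := hU.exists_iUnion_isClosed
  refine h.1.mul_apply_iUnion_eq_zero (fun n => (hC n).measurableSet) fun n => ?_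
  have hzero := h.apply_mul_mul_apply_compl_eq_zero h' hS (hC n).isOpen_compl
  rw [compl_compl] at hzero
  rw [← h'.1.mul_of_subset hU.measurableSet.compl (hC n).measurableSet.compl
    (Set.compl_subset_compl.mpr (Set.subset_iUnion C n)), mul_assoc, mul_assoc,
    ← mul_assoc (E' _) S, hzero, mul_zero]

theorem IsResolution.eqOn (h : IsResolution T.everywhere E) (h' : IsResolution T.everywhere E') :
    Set.EqOn E E' {s | MeasurableSet s} := fun s hs => by
  simpa using (h.semiconjBy_apply h' (SemiconjBy.one_left T) hs).eq

theorem IsResolution.borelCalculus_eq (h : IsResolution T.everywhere E) (f : ℂ → ℂ) :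
    borelCalculus T.everywhere f = calculus E f := by
  have hT : IsScalarTypeSpectral T.everywhere := ⟨E, h⟩
  rw [borelCalculus, dif_pos hT]
  exact calculus_congr_of_eqOn (hT.choose_spec.eqOn h) f

end SpectralMeasure

theorem IsSpectralMeasure.map {G : Type*} [NormedAddCommGroup G] [NormedSpace ℂ G]
    {E : Set ℂ → (G →L[ℂ] G)} (hE : IsSpectralMeasure E) {h : ℂ → ℂ} (hh : Measurable h) :
    IsSpectralMeasure fun s => E (h ⁻¹' s) where
  proj s hs := hE.proj _ (hh hs)
  inter s t hs ht := hE.inter _ _ (hh hs) (hh ht)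
  union s t hs ht := hE.union _ _ (hh hs) (hh ht)
  univ := hE.univ
  empty := hE.empty
  weak_countably_additive s hs hd x φ := by
    simpa only [Set.preimage_iUnion] using hE.weak_countably_additive (fun n => h ⁻¹' s n)
      (fun n => hh (hs n)) (fun m n hmn => (hd hmn).preimage h) x φ

namespace SpectralMeasure

variable {G : Type*} [NormedAddCommGroup G] [NormedSpace ℂ G] {E : Set ℂ → (G →L[ℂ] G)}
  {f h : ℂ → ℂ} {A T : G →L[ℂ] G}

theorem simpleIntegral_preimage (hE : IsSpectralMeasure E) (hh : Measurable h)
    (s : SimpleFunc ℂ ℂ) :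
    simpleIntegral (fun u => E (h ⁻¹' u)) s = simpleIntegral E (s.comp h hh) := by
  refine (Finset.sum_subset (SimpleFunc.range_comp_subset_range s hh) fun c _ hc => ?_).symm
  have hfiber : h ⁻¹' (s ⁻¹' {c}) = ∅ := by
    rw [← Set.preimage_comp, ← SimpleFunc.coe_comp s hh]
    exact (SimpleFunc.preimage_eq_empty_iff _ _).mpr hc
  simp only [hfiber, hE.empty, smul_zero]

theorem HasSpectralIntegral.comp (hE : IsSpectralMeasure E) (hh : Measurable h)
    (hf : HasSpectralIntegral (fun u => E (h ⁻¹' u)) f A) : HasSpectralIntegral E (f ∘ h) A := by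
  obtain ⟨s, hs, hs'⟩ := hf
  refine ⟨fun n => (s n).comp h hh, hs.comp h, ?_⟩
  simpa only [simpleIntegral_preimage hE hh] using hs'

theorem mapsTo_supp_preimage (hE : IsSpectralMeasure E) (hh : Continuous h) :
    Set.MapsTo h (supp E) (supp fun u => E (h ⁻¹' u)) :=
  supp_subset (isClosed_supp.preimage hh) (apply_supp (hE.map hh.measurable))

variable [CompleteSpace G]

theorem calculus_preimage (hE : IsSpectralMeasure E) (hh : Continuous h)
    (hf : Measurable ((supp fun u => E (h ⁻¹' u)).indicator f)) :
    calculus (fun u => E (h ⁻¹' u)) f = calculus E (f ∘ h) := by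
  have hmaps := mapsTo_supp_preimage hE hh
  have hfh : Measurable ((supp E).indicator (f ∘ h)) := by
    convert (hf.comp hh.measurable).indicator (measurableSet_supp (E := E)) using 1
    exact Set.indicator_congr fun z hz => (Set.indicator_of_mem (hmaps hz) f).symm
  refine calculus_congr_spectralIntegral_trunc fun n => ?_
  have himage := (hasSpectralIntegral_of_bounded (hE.map hh.measurable) (measurable_trunc hf n)
    ⟨n, norm_trunc_le n⟩).comp hE hh.measurable
  refine himage.unique_of_eqOn_supp hE
    (hasSpectralIntegral_of_bounded hE (measurable_trunc hfh n) ⟨n, norm_trunc_le n⟩)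
    fun z hz => ?_
  simp only [Function.comp_apply, trunc_apply hz, trunc_apply (hmaps hz)]
  rfl

theorem IsResolution.smul (hT : IsResolution T.everywhere E) (c : ℂ) :
    IsResolution (c • T).everywhere fun u => E ((fun z => c * z) ⁻¹' u) := by
  have hc : Continuous fun z : ℂ => c * z := by fun_prop
  refine ⟨hT.1.map hc.measurable, ?_⟩
  rw [calculus_preimage hT.1 hc (measurable_id'.indicator measurableSet_supp)]
  exact (calculus_eq_everywhere hT.1 (hT.hasSpectralIntegral_id.smul hT.1 c) fun z hz => by
    simp [hz]).symm

end SpectralMeasure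

section BorelCalculus

variable {G : Type*} [NormedAddCommGroup G] [NormedSpace ℂ G] [CompleteSpace G] {T : G →L[ℂ] G}

theorem IsScalarTypeSpectral.smul (hT : IsScalarTypeSpectral T.everywhere) (c : ℂ) :
    IsScalarTypeSpectral (c • T).everywhere :=
  let ⟨_, hE⟩ := hT
  ⟨_, hE.smul c⟩

theorem borelCalculus_smul (hT : IsScalarTypeSpectral T.everywhere) (c : ℂ) {f : ℂ → ℂ}
    (hf : Measurable ((spectrum ℂ (c • T)).indicator f)) :
    borelCalculus (c • T).everywhere f = borelCalculus T.everywhere fun z => f (c * z) := by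
  obtain ⟨E, hE⟩ := hT
  have hsupp := hf.indicator
    (SpectralMeasure.measurableSet_supp (E := fun u => E ((fun z => c * z) ⁻¹' u)))
  rw [Set.indicator_indicator, Set.inter_eq_left.mpr (hE.smul c).supp_subset_spectrum] at hsupp
  rw [(hE.smul c).borelCalculus_eq, hE.borelCalculus_eq]
  exact SpectralMeasure.calculus_preimage hE.1 (by fun_prop) hsupp

end BorelCalculus

theorem norm_extend_zero_apply_le {X Y F : Type*} [TopologicalSpace X] [CompactSpace X]
    [SeminormedAddCommGroup F] {e : X → Y} (he : Function.Injective e) (g : C(X, F)) (y : Y) :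
    ‖Function.extend e g 0 y‖ ≤ ‖g‖ := by
  by_cases hy : ∃ x, e x = y
  · obtain ⟨x, rfl⟩ := hy
    rw [he.extend_apply]
    exact g.norm_coe_le_norm x
  · rw [Function.extend_apply' _ _ _ hy, Pi.zero_apply, norm_zero]
    exact norm_nonneg g

namespace SpectralMeasure

variable {G : Type*} [NormedAddCommGroup G] [NormedSpace ℂ G] [CompleteSpace G]
  {E : Set ℂ → (G →L[ℂ] G)} {f : ℂ → ℂ} {A T : G →L[ℂ] G}

theorem IsResolution.isCompact_supp (hT : IsResolution T.everywhere E) : IsCompact (supp E) :=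
  (spectrum.isCompact T).of_isClosed_subset isClosed_supp hT.supp_subset_spectrum

theorem hasSpectralIntegral_extend [CompactSpace (supp E)] (hE : IsSpectralMeasure E)
    (g : C(supp E, ℂ)) : HasSpectralIntegral E (Function.extend Subtype.val g 0)
      (spectralIntegral E (Function.extend Subtype.val g 0)) :=
  hasSpectralIntegral_of_bounded hE
    ((MeasurableEmbedding.subtype_coe measurableSet_supp).measurable_extend
      g.continuous.measurable measurable_const)
    ⟨_, norm_extend_zero_apply_le Subtype.val_injective g⟩

theorem HasSpectralIntegral.spectralIntegral_extend [CompactSpace (supp E)]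
    (hE : IsSpectralMeasure E) (hf : HasSpectralIntegral E f A) {g : C(supp E, ℂ)}
    (hfg : ∀ z : supp E, f z = g z) : spectralIntegral E (Function.extend Subtype.val g 0) = A :=
  (hasSpectralIntegral_extend hE g).unique_of_eqOn_supp hE hf fun z hz =>
    (Subtype.val_injective.extend_apply g 0 ⟨z, hz⟩).trans (hfg ⟨z, hz⟩).symm

/-- The functional calculus of a compactly supported spectral measure, as a bounded linear map on
the continuous functions on the support; a function is integrated after extension by `0`. -/
noncomputable def continuousCalculus [CompactSpace (supp E)] (hE : IsSpectralMeasure E) :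
    C(supp E, ℂ) →L[ℂ] (G →L[ℂ] G) :=
  LinearMap.mkContinuousOfExistsBound
    { toFun := fun g => spectralIntegral E (Function.extend Subtype.val g 0)
      map_add' := fun g₁ g₂ => ((hasSpectralIntegral_extend hE g₁).add hE
        (hasSpectralIntegral_extend hE g₂)).spectralIntegral_extend hE fun z => by simp
      map_smul' := fun c g => ((hasSpectralIntegral_extend hE g).smul hE c).spectralIntegral_extend
        hE fun z => by simp }
    (let ⟨C, _, hC⟩ := exists_norm_integral_le hE
    ⟨C, fun g => hC (hasSpectralIntegral_extend hE g)
      (norm_extend_zero_apply_le Subtype.val_injective g)⟩)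

variable [CompactSpace (supp E)]

theorem HasSpectralIntegral.continuousCalculus_eq (hE : IsSpectralMeasure E)
    (hf : HasSpectralIntegral E f A) {g : C(supp E, ℂ)} (hfg : ∀ z : supp E, f z = g z) :
    continuousCalculus hE g = A :=
  hf.spectralIntegral_extend hE hfg

theorem calculus_eq_continuousCalculus (hE : IsSpectralMeasure E) {g : C(supp E, ℂ)}
    (hfg : ∀ z : supp E, f z = g z) : calculus E f = (continuousCalculus hE g).everywhere :=
  calculus_eq_everywhere hE (hasSpectralIntegral_extend hE g) fun z hz =>
    (hfg ⟨z, hz⟩).trans (Subtype.val_injective.extend_apply g 0 ⟨z, hz⟩).symm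

theorem continuousCalculus_mul (hE : IsSpectralMeasure E) (g₁ g₂ : C(supp E, ℂ)) :
    continuousCalculus hE (g₁ * g₂) = continuousCalculus hE g₁ * continuousCalculus hE g₂ :=
  ((hasSpectralIntegral_extend hE g₁).mul hE
    (hasSpectralIntegral_extend hE g₂)).continuousCalculus_eq hE fun z => by simp

theorem IsResolution.continuousCalculus_id (hT : IsResolution T.everywhere E) :
    continuousCalculus hT.1 (.restrict (supp E) (.id ℂ)) = T :=
  hT.hasSpectralIntegral_id.continuousCalculus_eq hT.1 fun z => by simp

end SpectralMeasure

theorem measurable_indicator_of_continuousOn {X F : Type*} [TopologicalSpace X] [MeasurableSpace X]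
    [OpensMeasurableSpace X] [TopologicalSpace F] [MeasurableSpace F] [BorelSpace F] [Zero F]
    {s : Set X} (hs : MeasurableSet s) {f : X → F} (hf : ContinuousOn f s) :
    Measurable (s.indicator f) := by
  classical
  rw [← Set.piecewise_eq_indicator]
  exact hf.measurable_piecewise continuousOn_const hs

theorem spectrum_smul_subset {B : Type*} [NormedRing B] [NormedAlgebra ℂ B] [CompleteSpace B]
    (a : B) (c : ℂ) : spectrum ℂ (c • a) ⊆ (fun z => c * z) '' spectrum ℂ a := by
  rcases subsingleton_or_nontrivial B with hB | hB
  · simp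
  · exact (spectrum.smul_eq_smul c a (spectrum.nonempty a)).subset

section Dilation

variable {I : Set ℝ} {U : Set ℂ}

theorem exists_continuousOn_dilation {K : Set ℂ} (h : ∀ t ∈ I, ∀ z ∈ K, (t : ℂ) * z ∈ U)
    {f : ℂ → ℂ} (hf : ContinuousOn f U) :
    ∃ p : ℝ → C(K, ℂ), ContinuousOn p I ∧ ∀ t ∈ I, ∀ z : K, p t z = f (t * z) := by
  have huncurry : ContinuousOn (Function.uncurry fun (t : ℝ) (z : ℂ) => f (t * z)) (I ×ˢ K) :=
    hf.comp (by fun_prop) fun tz htz => h tz.1 htz.1 tz.2 htz.2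
  refine ⟨_, ContinuousMap.continuousOn_mkD_restrict_of_uncurry _ 0 huncurry, fun t ht z => ?_⟩
  exact ContinuousMap.mkD_apply_of_continuousOn (hf.comp (by fun_prop) fun z hz => h t ht z hz)

theorem hasDerivAt_dilation {F F' : ℂ → ℂ} (hF : ∀ w ∈ U, HasDerivWithinAt F (F' w) U w) {z : ℂ}
    {t : ℝ} (ht : ∀ᶠ s : ℝ in 𝓝 t, (s : ℂ) * z ∈ U) :
    HasDerivAt (fun s : ℝ => F (s * z)) (z * F' (t * z)) t := by
  have hline : HasDerivAt (fun s : ℝ => (s : ℂ) * z) z t := by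
    simpa using (Complex.ofRealCLM.hasDerivAt (x := t)).mul_const z
  simpa [Function.comp_def, mul_comm] using (hF _ ht.self_of_nhds).comp_hasDerivAt t hline ht

end Dilation

section ContinuousMapCurve

variable {K F : Type*} [TopologicalSpace K] [CompactSpace K] [NormedAddCommGroup F]
  [NormedSpace ℝ F] [CompleteSpace F] {p q : ℝ → C(K, F)}

theorem integral_eq_sub_of_forall_hasDerivAt_apply {a b : ℝ} (hq : ContinuousOn q (Set.uIcc a b))
    (hpq : ∀ t ∈ Set.uIcc a b, ∀ z, HasDerivAt (fun s => p s z) (q t z) t) :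
    ∫ t in a..b, q t = p b - p a := by
  ext z
  calc (∫ t in a..b, q t) z = ∫ t in a..b, q t z :=
        ((ContinuousMap.evalCLM ℝ z).intervalIntegral_comp_comm hq.intervalIntegrable).symm
    _ = p b z - p a z := intervalIntegral.integral_eq_sub_of_hasDerivAt (fun t ht => hpq t ht z)
        ((ContinuousMap.evalCLM ℝ z).continuous.comp_continuousOn hq).intervalIntegrable

theorem hasDerivAt_of_forall_hasDerivAt_apply {I : Set ℝ} (hI : IsOpen I) (hq : ContinuousOn q I)
    (hpq : ∀ t ∈ I, ∀ z, HasDerivAt (fun s => p s z) (q t z) t) {t : ℝ} (ht : t ∈ I) :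
    HasDerivAt p (q t) t := by
  obtain ⟨ε, hε, hball⟩ := Metric.isOpen_iff.mp hI t ht
  have hprimitive : HasDerivAt (fun s => ∫ r in t..s, q r) (q t) t :=
    intervalIntegral.integral_hasDerivAt_right .refl
      (hq.stronglyMeasurableAtFilter hI t ht) (hq.continuousAt (hI.mem_nhds ht))
  refine (hprimitive.add_const (p t)).congr_of_eventuallyEq ?_
  filter_upwards [Metric.ball_mem_nhds t hε] with s hs
  have hsegment : Set.uIcc t s ⊆ I := ((convex_ball t ε).ordConnected.uIcc_subset
    (Metric.mem_ball_self hε) hs).trans hball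
  rw [integral_eq_sub_of_forall_hasDerivAt_apply (hq.mono hsegment)
    fun r hr => hpq r (hsegment hr), sub_add_cancel]

end ContinuousMapCurve

theorem mul_integral_eq_sub_of_hasDerivAt {B : Type*} [NormedRing B] [NormedAlgebra ℝ B]
    [CompleteSpace B] {a : B} {Φ Ψ : ℝ → B} {u₁ u₂ : ℝ}
    (hΨ : IntervalIntegrable Ψ volume u₁ u₂)
    (hΦ : ∀ t ∈ Set.uIcc u₁ u₂, HasDerivAt Φ (a * Ψ t) t) :
    a * ∫ t in u₁..u₂, Ψ t = Φ u₂ - Φ u₁ := by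
  have hmul : a * ∫ t in u₁..u₂, Ψ t = ∫ t in u₁..u₂, a * Ψ t :=
    ((ContinuousLinearMap.mul ℝ B a).intervalIntegral_comp_comm hΨ).symm
  rw [hmul, intervalIntegral.integral_eq_sub_of_hasDerivAt hΦ (hΨ.const_mul a)]

namespace SpectralMeasure.IsResolution

variable {G : Type*} [NormedAddCommGroup G] [NormedSpace ℂ G] [CompleteSpace G] {T : G →L[ℂ] G}
  {E : Set ℂ → (G →L[ℂ] G)} [CompactSpace (supp E)]

theorem borelCalculus_smul_eq (hE : IsResolution T.everywhere E) {c : ℂ} {f : ℂ → ℂ}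
    (hf : ContinuousOn f (spectrum ℂ (c • T))) {g : C(supp E, ℂ)}
    (hfg : ∀ z : supp E, g z = f (c * z)) :
    borelCalculus (c • T).everywhere f = (continuousCalculus hE.1 g).everywhere := by
  rw [borelCalculus_smul ⟨E, hE⟩ c
    (measurable_indicator_of_continuousOn (spectrum.isClosed _).measurableSet hf),
    hE.borelCalculus_eq]
  exact calculus_eq_continuousCalculus hE.1 fun z => (hfg z).symm

theorem hasDerivAt_continuousCalculus (hE : IsResolution T.everywhere E) {I : Set ℝ}
    (hI : IsOpen I) {p q : ℝ → C(supp E, ℂ)} (hq : ContinuousOn q I)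
    (hpq : ∀ t ∈ I, ∀ z : supp E, HasDerivAt (fun s => p s z) (z * q t z) t) {t : ℝ} (ht : t ∈ I) :
    HasDerivAt (fun s => continuousCalculus hE.1 (p s)) (T * continuousCalculus hE.1 (q t)) t := by
  let ι : C(supp E, ℂ) := .restrict (supp E) (.id ℂ)
  have hp : HasDerivAt p (ι * q t) t :=
    hasDerivAt_of_forall_hasDerivAt_apply hI (continuousOn_const.mul hq) hpq ht
  have hA := ((continuousCalculus hE.1).restrictScalars ℝ).hasFDerivAt.comp_hasDerivAt t hp
  rwa [ContinuousLinearMap.coe_restrictScalars', continuousCalculus_mul,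
    hE.continuousCalculus_id] at hA

end SpectralMeasure.IsResolution

theorem theorem19500603_general {G : Type*} [NormedAddCommGroup G] [NormedSpace ℂ G]
    [CompleteSpace G] (T : G →L[ℂ] G) (hT : IsScalarTypeSpectral T.everywhere) {I : Set ℝ}
    (hI : IsOpen I) {U : Set ℂ} (hIU : ∀ t ∈ I, ∀ z ∈ spectrum ℂ T, (t : ℂ) * z ∈ U)
    {F F' : ℂ → ℂ} (hF : ∀ w ∈ U, HasDerivWithinAt F (F' w) U w) (hF' : ContinuousOn F' U) :
    ∃ Φ Ψ : ℝ → (G →L[ℂ] G),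
      (∀ t ∈ I,
        (IsScalarTypeSpectral ((t : ℂ) • T).everywhere ∧ spectrum ℂ ((t : ℂ) • T) ⊆ U) ∧
        borelCalculus ((t : ℂ) • T).everywhere F = (Φ t).everywhere ∧
        borelCalculus ((t : ℂ) • T).everywhere F' = (Ψ t).everywhere ∧
        borelCalculus ((t : ℂ) • T).everywhere F
          = borelCalculus T.everywhere (fun z => F ((t : ℂ) * z)) ∧
        HasDerivAt Φ (T * Ψ t) t) ∧
      ∀ u₁ u₂ : ℝ, Set.uIcc u₁ u₂ ⊆ I →
        IntervalIntegrable Ψ volume u₁ u₂ ∧ T * (∫ t in u₁..u₂, Ψ t) = Φ u₂ - Φ u₁ := by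
  obtain ⟨E, hE⟩ := hT
  have : CompactSpace (SpectralMeasure.supp E) := isCompact_iff_compactSpace.mp hE.isCompact_supp
  have hIS : ∀ t ∈ I, ∀ z ∈ SpectralMeasure.supp E, (t : ℂ) * z ∈ U :=
    fun t ht z hz => hIU t ht z (hE.supp_subset_spectrum hz)
  have hspec : ∀ t ∈ I, spectrum ℂ ((t : ℂ) • T) ⊆ U := fun t ht =>
    (spectrum_smul_subset T t).trans (Set.image_subset_iff.mpr (hIU t ht))
  have hFc : ContinuousOn F U := fun w hw => (hF w hw).continuousWithinAt
  obtain ⟨p, -, hp⟩ := exists_continuousOn_dilation hIS hFc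
  obtain ⟨q, hq, hq'⟩ := exists_continuousOn_dilation hIS hF'
  have hpq : ∀ t ∈ I, ∀ z : SpectralMeasure.supp E,
      HasDerivAt (fun s => p s z) (z * q t z) t := fun t ht z => by
    have hnear : ∀ᶠ s in 𝓝 t, s ∈ I := hI.mem_nhds ht
    rw [hq' t ht z]
    exact (hasDerivAt_dilation hF (hnear.mono fun s hs => hIS s hs z z.2)).congr_of_eventuallyEq
      (hnear.mono fun s hs => hp s hs z)
  let A := SpectralMeasure.continuousCalculus hE.1
  have hΦ : ∀ t ∈ I, HasDerivAt (fun s => A (p s)) (T * A (q t)) t := fun t ht =>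
    hE.hasDerivAt_continuousCalculus hI hq hpq ht
  have hΨ : ContinuousOn (fun t => A (q t)) I := A.continuous.comp_continuousOn hq
  refine ⟨fun t => A (p t), fun t => A (q t), fun t ht => ⟨⟨.smul ⟨E, hE⟩ t, hspec t ht⟩,
    hE.borelCalculus_smul_eq (hFc.mono (hspec t ht)) (hp t ht),
    hE.borelCalculus_smul_eq (hF'.mono (hspec t ht)) (hq' t ht),
    borelCalculus_smul ⟨E, hE⟩ t (measurable_indicator_of_continuousOn
      (spectrum.isClosed _).measurableSet (hFc.mono (hspec t ht))), hΦ t ht⟩, fun u₁ u₂ hu => ?_⟩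
  have hint : IntervalIntegrable (fun t => A (q t)) volume u₁ u₂ := (hΨ.mono hu).intervalIntegrable
  exact ⟨hint, mul_integral_eq_sub_of_hasDerivAt hint fun t ht => hΦ t (hu ht)⟩

/-- `Φ t` is the bounded operator `F(tT)` and `Ψ t` the bounded operator `F'(tT)`, both formed by
the Borel functional calculus of the operator `tT`. -/
theorem theorem19500603 {G : Type*} [NormedAddCommGroup G] [NormedSpace ℂ G] [CompleteSpace G]
    (T : G →L[ℂ] G) (hT : IsScalarTypeSpectral T.everywhere)
    (L : EReal) (hL : 0 < L)
    (U : Set ℂ) (hU : IsOpen U) (hTU : spectrum ℂ T ⊆ U)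
    (hLU : ∀ t : ℝ, -L < (t : EReal) → (t : EReal) < L → ∀ z ∈ U, (t : ℂ) * z ∈ U)
    (F : ℂ → ℂ) (hF : AnalyticOnNhd ℂ F U) :
    ∃ Φ Ψ : ℝ → (G →L[ℂ] G),
      (∀ t : ℝ, -L < (t : EReal) → (t : EReal) < L →
        (IsScalarTypeSpectral ((t : ℂ) • T).everywhere ∧ spectrum ℂ ((t : ℂ) • T) ⊆ U) ∧
        borelCalculus ((t : ℂ) • T).everywhere F = (Φ t).everywhere ∧
        borelCalculus ((t : ℂ) • T).everywhere (deriv F) = (Ψ t).everywhere ∧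
        borelCalculus ((t : ℂ) • T).everywhere F
          = borelCalculus T.everywhere (fun z => F ((t : ℂ) * z)) ∧
        HasDerivAt Φ (T * Ψ t) t) ∧
      (∀ u₁ u₂ : ℝ, -L < (u₁ : EReal) → (u₁ : EReal) < L → -L < (u₂ : EReal) → (u₂ : EReal) < L →
        IntervalIntegrable Ψ volume u₁ u₂ ∧
        T * (∫ t in u₁..u₂, Ψ t) = Φ u₂ - Φ u₁) := by
  let I : Set ℝ := {t : ℝ | -L < (t : EReal) ∧ (t : EReal) < L}
  have hIopen : IsOpen I := (isOpen_Ioo (a := -L) (b := L)).preimage continuous_coe_real_ereal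
  have hIord : I.OrdConnected :=
    (Set.ordConnected_Ioo (a := -L) (b := L)).preimage_mono EReal.coe_strictMono.monotone
  obtain ⟨Φ, Ψ, hpointwise, hintegral⟩ := theorem19500603_general T hT hIopen
    (fun t ht z hz => hLU t ht.1 ht.2 z (hTU hz))
    (fun w hw => (hF w hw).differentiableAt.hasDerivAt.hasDerivWithinAt) hF.deriv.continuousOn
  exact ⟨Φ, Ψ, fun t h₁ h₂ => hpointwise t ⟨h₁, h₂⟩, fun u₁ u₂ h₁ h₁' h₂ h₂' =>
    hintegral u₁ u₂ (hIord.uIcc_subset ⟨h₁, h₁'⟩ ⟨h₂, h₂'⟩)⟩
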